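/- Let $\mathbb{P}$ be a non-empty partition (possibly infinite) of the sure event, identified with a non-empty set $\Omega$, and let $\mathcal{A}$ be the set of events logically dependent on it (the powerset of $\Omega$). A conditional event $A|B$ is given by $A\subseteq\Omega$ and $\emptyset\neq B\subseteq\Omega$, where $A|B$ is identified with $(A\cap B)|B$, and $A|\Omega$ with $A$; write $I_A$ for the indicator of $A$. Let $\mathcal{D}$ be a set of conditional events. A function $\underline{P}:\mathcal{D}\to\mathbb{R}$ is W-coherent (Williams-coherent) if for all $n\ge 0$, all $A_0|B_0,\dots,A_n|B_n\in\mathcal{D}$ and all real $s_0,\dots,s_n\ge 0$ the gain $G=\sum_{i=1}^n s_iI_{B_i}(I_{A_i}-\underline{P}(A_i|B_i))-s_0I_{B_0}(I_{A_0}-\underline{P}(A_0|B_0))$ satisfies $\sup_{\omega\in B_0\cup\dots\cup B_n}G(\omega)\ge 0$. A (precise) probability on $\mathcal{D}$ is a function $P:\mathcal{D}\to\mathbb{R}$ that is coherent in the sense of de Finetti: for all $n\ge 0$, all $A_0|B_0,\dots,A_n|B_n\in\mathcal{D}$ and all real $s_0,\dots,s_n$, $\sup_{\omega\in B_0\cup\dots\cup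 B_n}\sum_{i=0}^n s_iI_{B_i}(\omega)(I_{A_i}(\omega)-P(A_i|B_i))\ge 0$. Let $\underline{P}:\mathcal{A}\to\mathbb{R}$ be a W-coherent lower probability, $\overline{P}(A)=1-\underline{P}(A^c)$ its conjugate, $\mathcal{M}=\{P \text{ probability on } \mathcal{A}: P\ge\underline{P}\}$ its credal set, and let $\emptyset\ne B\in\mathcal{A}$. Put $\mathcal{A}|B=\{A|B:A\in\mathcal{A}\}$, $\mathcal{M}^+=\{P\in\mathcal{M}:P(B)>0\}$, and let $\mathcal{M}^+_B$ be the set of all probabilities on $\mathcal{A}\cup\mathcal{A}|B$ whose restriction to $\mathcal{A}$ lies in $\mathcal{M}^+$. Let the natural extension $\underline{E}$ of $\underline{P}$ to $\mathcal{A}\cup\mathcal{A}|B$ be the pointwise infimum of all W-coherent extensions of $\underline{P}$ to $\mathcal{A}\cup\mathcal{A}|B$. 1. Suppose $\underline{P}(B)=0<\overline{P}(B)$. Then $\mathcal{M}^+\neq\varnothing$, and $\underline{R}=\inf_{P\in\mathcal{M}^+_B}P$ (pointwise) satisfies: (a) $\underline{R}:\mathcal{A}\cup\mathcal{A}|B\to\mathbb{R}$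 is a W-coherent lower probability; (b) $\underline{R}=\underline{P}$ on $\mathcal{A}$. 2. In general (without assuming $\underline{P}(B)=0<\overline{P}(B)$), $\underline{E}$ is the least W-coherent extension of $\underline{P}$ to $\mathcal{A}\cup\mathcal{A}|B$, and the regular extension $\underline{R}$ of $\underline{P}$ to $\mathcal{A}\cup\mathcal{A}|B$, defined as $\inf_{P\in\mathcal{M}^+_B}P$ if $\mathcal{M}^+\neq\varnothing$ and as $\underline{E}$ if $\mathcal{M}^+=\varnothing$, is W-coherent and satisfies $\underline{R}=\underline{E}=\underline{P}$ on $\mathcal{A}$. -/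

import Mathlib

/-- A conditional event `A|B` over the possibility space `Ω` (the atoms of the partition): the
conditioning event `given` is nonempty. Since `A|B` and `(A ∩ B)|B` are the same conditional
event, `event` is normalised to be a subset of `given`. -/
structure CondEvent (Ω : Type*) where
  event : Set Ω
  given : Set Ω
  given_nonempty : given.Nonempty
  event_subset : event ⊆ given

namespace CondEvent

variable {Ω : Type*}

/-- The conditional event `A|B`. -/
def cond (A B : Set Ω) (hB : B.Nonempty) : CondEvent Ω :=
  ⟨A ∩ B, B, hB, Set.inter_subset_right⟩

/-- The unconditional event `A`, i.e. `A|Ω`. -/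
def uncond [Nonempty Ω] (A : Set Ω) : CondEvent Ω :=
  cond A Set.univ Set.univ_nonempty

/-- The gain `I_B (I_A - p)` from buying `A|B` at price `p`, as a function on `Ω`. -/
noncomputable def gain (E : CondEvent Ω) (p : ℝ) (ω : Ω) : ℝ :=
  E.given.indicator 1 ω * (E.event.indicator 1 ω - p)

end CondEvent

/-- Williams coherence (structure-free form) of a lower probability `P` on an arbitrary set `𝒟`
of conditional events: for finitely many bets in favour of `E i` with stakes `s i ≥ 0` and one
bet against `E₀` with stake `s₀ ≥ 0`, the supremum of the overall gain, conditional on the union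
of the conditioning events involved, is nonnegative. -/
def WCoherent {Ω : Type*} {𝒟 : Set (CondEvent Ω)} (P : 𝒟 → ℝ) : Prop :=
  ∀ (n : ℕ) (E₀ : 𝒟) (E : Fin n → 𝒟) (s₀ : ℝ) (s : Fin n → ℝ),
    0 ≤ s₀ → (∀ i, 0 ≤ s i) →
      0 ≤ sSup ((fun ω => (∑ i, s i * (E i).1.gain (P (E i)) ω) - s₀ * E₀.1.gain (P E₀) ω) ''
        (E₀.1.given ∪ ⋃ i, (E i).1.given))

/-- Precise probabilities: de Finetti coherence of `P` on an arbitrary set `𝒟` of conditional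
events. Same as above, with stakes of arbitrary sign. -/
def DFCoherent {Ω : Type*} {𝒟 : Set (CondEvent Ω)} (P : 𝒟 → ℝ) : Prop :=
  ∀ (n : ℕ) (E : Fin (n + 1) → 𝒟) (s : Fin (n + 1) → ℝ),
    0 ≤ sSup ((fun ω => ∑ i, s i * (E i).1.gain (P (E i)) ω) '' (⋃ i, (E i).1.given))

/-- The credal set of `P`: all precise probabilities on the same domain that dominate `P`. -/
def credalSet {Ω : Type*} {𝒟 : Set (CondEvent Ω)} (P : 𝒟 → ℝ) : Set (𝒟 → ℝ) :=
  {Q | DFCoherent Q ∧ ∀ E, P E ≤ Q E}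

/-- Restriction of a function on `𝒟'` to a smaller domain `𝒟`. -/
def restrictTo {Ω : Type*} {𝒟 𝒟' : Set (CondEvent Ω)} (h : 𝒟 ⊆ 𝒟') (Q : 𝒟' → ℝ) : 𝒟 → ℝ :=
  fun E => Q (Set.inclusion h E)

/-- The W-coherent extensions of `P : 𝒟 → ℝ` to `𝒟' ⊇ 𝒟`. -/
def coherentExtensions {Ω : Type*} {𝒟 𝒟' : Set (CondEvent Ω)} (h : 𝒟 ⊆ 𝒟') (P : 𝒟 → ℝ) :
    Set (𝒟' → ℝ) :=
  {Q | WCoherent Q ∧ restrictTo h Q = P}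

/-- The natural extension of `P` to `𝒟'`: the least W-coherent extension, constructed as the
pointwise infimum of all W-coherent extensions. -/
noncomputable def naturalExtension {Ω : Type*} {𝒟 𝒟' : Set (CondEvent Ω)} (h : 𝒟 ⊆ 𝒟')
    (P : 𝒟 → ℝ) : 𝒟' → ℝ :=
  fun E => sInf ((fun Q : 𝒟' → ℝ => Q E) '' coherentExtensions h P)

section Conditioning

variable {Ω : Type*} [Nonempty Ω]

/-- The set of all unconditional events (the powerset of `Ω`). -/
def uncondEvents (Ω : Type*) [Nonempty Ω] : Set (CondEvent Ω) :=
  Set.range CondEvent.uncond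

/-- All unconditional events together with all conditional events `A|B`, for the given `B`. -/
def condDomain (B : Set Ω) (hB : B.Nonempty) : Set (CondEvent Ω) :=
  uncondEvents Ω ∪ Set.range (fun A => CondEvent.cond A B hB)

theorem uncondEvents_subset_condDomain (B : Set Ω) (hB : B.Nonempty) :
    uncondEvents Ω ⊆ condDomain B hB :=
  Set.subset_union_left

/-- The unconditional event `A` as an element of `uncondEvents Ω`. -/
def toUncond (A : Set Ω) : uncondEvents Ω :=
  ⟨CondEvent.uncond A, A, rfl⟩

/-- The upper probability conjugate to `P`, evaluated at the unconditional event `A`. -/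
def upperProb (P : uncondEvents Ω → ℝ) (A : Set Ω) : ℝ :=
  1 - P (toUncond Aᶜ)

/-- `M⁺`: the members of the credal set of `P` that give positive probability to `B`. -/
def credalPos (P : uncondEvents Ω → ℝ) (B : Set Ω) : Set (uncondEvents Ω → ℝ) :=
  {Q | Q ∈ credalSet P ∧ 0 < Q (toUncond B)}

/-- `M⁺_B`: the precise probabilities on `condDomain B hB` that extend an element of `M⁺`. -/
def credalPosCond (P : uncondEvents Ω → ℝ) (B : Set Ω) (hB : B.Nonempty) :
    Set (condDomain B hB → ℝ) :=
  {Q | DFCoherent Q ∧ restrictTo (uncondEvents_subset_condDomain B hB) Q ∈ credalPos P B}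

/-- The lower envelope `inf_{Q ∈ M⁺_B} Q`. -/
noncomputable def regularEnvelope (P : uncondEvents Ω → ℝ) (B : Set Ω) (hB : B.Nonempty) :
    condDomain B hB → ℝ :=
  fun E => sInf ((fun Q : condDomain B hB → ℝ => Q E) '' credalPosCond P B hB)

open Classical in
/-- The regular extension of `P` to `condDomain B hB`: the lower envelope of `M⁺_B` if `M⁺` is
nonempty, the natural extension otherwise. -/
noncomputable def regularExtension (P : uncondEvents Ω → ℝ) (B : Set Ω) (hB : B.Nonempty) :
    condDomain B hB → ℝ :=
  if (credalPos P B).Nonempty then regularEnvelope P B hB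
  else naturalExtension (uncondEvents_subset_condDomain B hB) P

end Conditioning

section Coherence

variable {Ω : Type*}

/-- A function with bounded absolute value. -/
def IsBddFun (f : Ω → ℝ) : Prop := ∃ C, ∀ ω, |f ω| ≤ C

namespace IsBddFun

variable {f g : Ω → ℝ}

theorem add (hf : IsBddFun f) (hg : IsBddFun g) : IsBddFun (f + g) := by
  obtain ⟨C, hC⟩ := hf
  obtain ⟨D, hD⟩ := hg
  exact ⟨C + D, fun ω => (abs_add_le _ _).trans (add_le_add (hC ω) (hD ω))⟩

theorem smul (c : ℝ) (hf : IsBddFun f) : IsBddFun (c • f) := by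
  obtain ⟨C, hC⟩ := hf
  refine ⟨|c| * C, fun ω => ?_⟩
  rw [Pi.smul_apply, smul_eq_mul, abs_mul]
  exact mul_le_mul_of_nonneg_left (hC ω) (abs_nonneg c)

theorem sub (hf : IsBddFun f) (hg : IsBddFun g) : IsBddFun (f - g) := by
  have := hf.add (hg.smul (-1))
  rwa [neg_one_smul, ← sub_eq_add_neg] at this

theorem const (c : ℝ) : IsBddFun (fun _ : Ω => c) := ⟨|c|, fun _ => le_rfl⟩

theorem one : IsBddFun (1 : Ω → ℝ) := const 1

theorem indicator_one (A : Set Ω) : IsBddFun (A.indicator (1 : Ω → ℝ)) :=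
  ⟨1, fun ω => by by_cases h : ω ∈ A <;> simp [h]⟩

theorem sum {ι : Type*} (t : Finset ι) (F : ι → Ω → ℝ) (hF : ∀ i ∈ t, IsBddFun (F i)) :
    IsBddFun (∑ i ∈ t, F i) :=
  Finset.sum_induction F IsBddFun (fun _ _ => add) (const 0) hF

end IsBddFun

/-- The space of bounded real functions. -/
def bddFun (Ω : Type*) : Submodule ℝ (Ω → ℝ) where
  carrier := {f | IsBddFun f}
  add_mem' := IsBddFun.add
  zero_mem' := IsBddFun.const 0
  smul_mem' c _ hf := hf.smul c

/-- A linear functional that restricts to a finitely additive expectation on bounded functions. -/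
structure IsExpectation (L : (Ω → ℝ) →ₗ[ℝ] ℝ) : Prop where
  nonneg : ∀ f, IsBddFun f → 0 ≤ f → 0 ≤ L f
  map_one : L 1 = 1

namespace IsExpectation

variable {L L' : (Ω → ℝ) →ₗ[ℝ] ℝ}

theorem mono (hL : IsExpectation L) {f g : Ω → ℝ} (hf : IsBddFun f) (hg : IsBddFun g)
    (h : f ≤ g) : L f ≤ L g := by
  have := hL.nonneg (g - f) (hg.sub hf) (sub_nonneg.2 h)
  rw [map_sub] at this
  linarith

theorem indicator_nonneg (hL : IsExpectation L) (A : Set Ω) :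
    0 ≤ L (A.indicator (1 : Ω → ℝ)) :=
  hL.nonneg _ (.indicator_one A) (Set.indicator_nonneg fun _ _ => zero_le_one)

theorem indicator_compl (hL : IsExpectation L)
    (A : Set Ω) : L (Aᶜ.indicator 1) = 1 - L (A.indicator 1) := by
  rw [Set.indicator_compl, map_sub, hL.map_one]

theorem indicator_le_one (hL : IsExpectation L)
    (A : Set Ω) : L (A.indicator 1) ≤ 1 := by
  have := hL.indicator_nonneg Aᶜ
  rw [hL.indicator_compl] at this
  linarith

/-- Evaluation at a point is an expectation. -/
theorem proj (ω : Ω) : IsExpectation (LinearMap.proj (R := ℝ) (φ := fun _ : Ω => ℝ) ω) :=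
  ⟨fun _ _ h => h ω, rfl⟩

theorem convexCombo (hL : IsExpectation L) (hL' : IsExpectation L') {t : ℝ} (h0 : 0 ≤ t)
    (h1 : t ≤ 1) : IsExpectation ((1 - t) • L + t • L') := by
  refine ⟨fun f hf h => ?_, ?_⟩
  · have := mul_nonneg (sub_nonneg.2 h1) (hL.nonneg f hf h)
    have := mul_nonneg h0 (hL'.nonneg f hf h)
    simp only [LinearMap.add_apply, LinearMap.smul_apply, smul_eq_mul]
    linarith
  · simp [hL.map_one, hL'.map_one]

/-- A gamble with expectation zero that vanishes off a set of positive probability has nonnegative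
supremum on that set. -/
theorem sSup_image_nonneg (hL : IsExpectation L) {G : Ω → ℝ} {S : Set Ω} (hG : IsBddFun G)
    (h0 : L G = 0) (hS : 0 < L (S.indicator 1)) (hoff : ∀ ω ∉ S, G ω = 0) :
    0 ≤ sSup (G '' S) := by
  by_contra! hneg
  have hbdd : BddAbove (G '' S) := by
    obtain ⟨C, hC⟩ := hG
    exact ⟨C, Set.forall_mem_image.2 fun ω _ => (le_abs_self _).trans (hC ω)⟩
  have hle : G ≤ sSup (G '' S) • S.indicator (1 : Ω → ℝ) := by
    intro ω
    by_cases h : ω ∈ S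
    · simpa [h] using le_csSup hbdd (Set.mem_image_of_mem G h)
    · simp [h, hoff ω h]
  have := hL.mono hG ((IsBddFun.indicator_one S).smul _) hle
  rw [h0, map_smul, smul_eq_mul] at this
  exact absurd this (not_le.2 (mul_neg_of_neg_of_pos hneg hS))

end IsExpectation

theorem exists_neg_lt_of_sSup_image_nonneg {G : Ω → ℝ} {S : Set Ω} (hS : S.Nonempty)
    (h : 0 ≤ sSup (G '' S)) {ε : ℝ} (hε : 0 < ε) : ∃ ω ∈ S, -ε < G ω := by
  obtain ⟨_, ⟨ω, hω, rfl⟩, hlt⟩ :=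
    exists_lt_of_lt_csSup (hS.image G) (show -ε < sSup (G '' S) by linarith)
  exact ⟨ω, hω, hlt⟩

namespace CondEvent

theorem gain_eq (E : CondEvent Ω) (p : ℝ) :
    E.gain p = E.event.indicator 1 - p • E.given.indicator (1 : Ω → ℝ) := by
  ext ω
  by_cases hg : ω ∈ E.given
  · simp [gain, hg]
  · have he : ω ∉ E.event := fun h => hg (E.event_subset h)
    simp [gain, hg, he]

theorem isBddFun_gain (E : CondEvent Ω) (p : ℝ) : IsBddFun (E.gain p) := by
  rw [gain_eq]
  exact (IsBddFun.indicator_one _).sub ((IsBddFun.indicator_one _).smul p)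

theorem gain_of_notMem (E : CondEvent Ω) (p : ℝ) {ω : Ω} (h : ω ∉ E.given) :
    E.gain p ω = 0 := by
  simp [gain, h]

end CondEvent

open CondEvent

theorem sum_smul_gain_apply {𝒟 : Set (CondEvent Ω)} (Q : 𝒟 → ℝ) {n : ℕ} (E : Fin n → 𝒟)
    (s : Fin n → ℝ) (ω : Ω) :
    (∑ i, s i • (E i).1.gain (Q (E i))) ω = ∑ i, s i * (E i).1.gain (Q (E i)) ω := by
  simp [Finset.sum_apply]

theorem isBddFun_sum_gain {𝒟 : Set (CondEvent Ω)} (Q : 𝒟 → ℝ) {n : ℕ} (E : Fin n → 𝒟)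
    (s : Fin n → ℝ) : IsBddFun (∑ i, s i • (E i).1.gain (Q (E i))) :=
  .sum _ _ fun _ _ => (isBddFun_gain _ _).smul _

/-- De Finetti coherence follows if every finite family of conditional events in the domain is
fairly priced by an expectation for which some conditioning event has positive probability. -/
theorem dfCoherent_of_expectation {𝒟 : Set (CondEvent Ω)} {Q : 𝒟 → ℝ}
    (h : ∀ (n : ℕ) (E : Fin (n + 1) → 𝒟), ∃ L, IsExpectation L ∧
      (∀ i, L ((E i).1.gain (Q (E i))) = 0) ∧ ∃ i, 0 < L ((E i).1.given.indicator 1)) :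
    DFCoherent Q := by
  intro n E s
  obtain ⟨L, hL, h0, j, hj⟩ := h n E
  rw [show (fun ω => ∑ i, s i * (E i).1.gain (Q (E i)) ω) = ∑ i, s i • (E i).1.gain (Q (E i)) from
    funext fun ω => (sum_smul_gain_apply Q E s ω).symm]
  refine hL.sSup_image_nonneg (isBddFun_sum_gain Q E s) ?_ ?_ ?_
  · simp only [map_sum, map_smul, h0, smul_zero, Finset.sum_const_zero]
  · refine hj.trans_le (hL.mono (.indicator_one _) (.indicator_one _) ?_)
    exact Set.indicator_le_indicator_of_subset (Set.subset_iUnion (fun i => (E i).1.given) j)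
      (fun _ => zero_le_one)
  · intro ω hω
    rw [sum_smul_gain_apply]
    refine Finset.sum_eq_zero fun i _ => ?_
    rw [gain_of_notMem _ _ fun hi => hω (Set.mem_iUnion.2 ⟨i, hi⟩), mul_zero]

theorem DFCoherent.wCoherent {𝒟 : Set (CondEvent Ω)} {Q : 𝒟 → ℝ} (hQ : DFCoherent Q) :
    WCoherent Q := by
  intro n E₀ E s₀ s _ _
  have := hQ n (Fin.cons E₀ E) (Fin.cons (-s₀) s)
  convert this using 3
  · ext ω
    simp [Fin.sum_univ_succ]
    ring
  · ext ω
    simp [Fin.exists_fin_succ]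

theorem WCoherent.nonneg {𝒟 : Set (CondEvent Ω)} {Q : 𝒟 → ℝ} (hQ : WCoherent Q) (E : 𝒟) :
    0 ≤ Q E := by
  have h := hQ 0 E Fin.elim0 1 Fin.elim0 zero_le_one (fun i => i.elim0)
  refine le_of_forall_pos_lt_add fun ε hε => ?_
  obtain ⟨ω, hω, hlt⟩ :=
    exists_neg_lt_of_sSup_image_nonneg (E.1.given_nonempty.mono Set.subset_union_left) h hε
  have hg : ω ∈ E.1.given := by simpa using hω
  have : (0 : ℝ) ≤ E.1.event.indicator 1 ω := Set.indicator_nonneg (fun _ _ => zero_le_one) ω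
  simp [gain, hg] at hlt
  linarith

/-- The pointwise infimum of a nonempty set of W-coherent lower probabilities is W-coherent. -/
theorem wCoherent_sInf {𝒟 : Set (CondEvent Ω)} {F : Set (𝒟 → ℝ)} (hne : F.Nonempty)
    (hF : ∀ Q ∈ F, WCoherent Q) :
    WCoherent (fun E => sInf ((fun Q : 𝒟 → ℝ => Q E) '' F)) := by
  intro n E₀ E s₀ s hs₀ hs
  set R : 𝒟 → ℝ := fun E => sInf ((fun Q : 𝒟 → ℝ => Q E) '' F) with hR
  have hle : ∀ Q ∈ F, ∀ E, R E ≤ Q E := fun Q hQ E =>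
    csInf_le ⟨0, Set.forall_mem_image.2 fun Q' hQ' => (hF Q' hQ').nonneg E⟩
      (Set.mem_image_of_mem _ hQ)
  have hbdd : BddAbove ((fun ω => (∑ i, s i * (E i).1.gain (R (E i)) ω) -
      s₀ * E₀.1.gain (R E₀) ω) '' (E₀.1.given ∪ ⋃ i, (E i).1.given)) := by
    obtain ⟨C, hC⟩ := (isBddFun_sum_gain R E s).sub ((isBddFun_gain E₀.1 (R E₀)).smul s₀)
    refine ⟨C, Set.forall_mem_image.2 fun ω _ => (le_abs_self _).trans ?_⟩
    simpa [Finset.sum_apply] using hC ω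
  refine le_of_forall_pos_lt_add fun ε hε => ?_
  obtain ⟨δ, hδ, hδε⟩ : ∃ δ > 0, s₀ * δ ≤ ε / 2 := by
    refine ⟨ε / 2 / (s₀ + 1), by positivity, ?_⟩
    rw [mul_div_assoc', div_le_iff₀ (by positivity)]
    nlinarith
  obtain ⟨_, ⟨Q, hQ, rfl⟩, hQlt⟩ :=
    exists_lt_of_csInf_lt (hne.image (fun Q : 𝒟 → ℝ => Q E₀)) (show R E₀ < R E₀ + δ by linarith)
  obtain ⟨ω, hω, hlt⟩ := exists_neg_lt_of_sSup_image_nonneg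
    (E₀.1.given_nonempty.mono Set.subset_union_left) (hF Q hQ n E₀ E s₀ s hs₀ hs) (half_pos hε)
  have hsum : ∑ i, s i * (E i).1.gain (Q (E i)) ω ≤ ∑ i, s i * (E i).1.gain (R (E i)) ω := by
    refine Finset.sum_le_sum fun i _ => mul_le_mul_of_nonneg_left ?_ (hs i)
    refine mul_le_mul_of_nonneg_left (sub_le_sub_left (hle Q hQ _) _) ?_
    exact Set.indicator_nonneg (fun _ _ => zero_le_one) ω
  have hbet : s₀ * E₀.1.gain (R E₀) ω ≤ s₀ * E₀.1.gain (Q E₀) ω + s₀ * δ := by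
    rw [← mul_add]
    refine mul_le_mul_of_nonneg_left ?_ hs₀
    by_cases hg : ω ∈ E₀.1.given
    · simp only [gain, Set.indicator_of_mem hg, Pi.one_apply, one_mul]
      linarith
    · rw [gain_of_notMem _ _ hg, gain_of_notMem _ _ hg]
      linarith
  have := le_csSup hbdd (Set.mem_image_of_mem _ hω)
  linarith

theorem restrictTo_sInf {𝒟 𝒟' : Set (CondEvent Ω)} (h : 𝒟 ⊆ 𝒟') {P : 𝒟 → ℝ}
    {F : Set (𝒟' → ℝ)} (hle : ∀ Q ∈ F, ∀ E, P E ≤ restrictTo h Q E)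
    (hlt : ∀ E, ∀ ε > 0, ∃ Q ∈ F, restrictTo h Q E < P E + ε) :
    restrictTo h (fun E => sInf ((fun Q : 𝒟' → ℝ => Q E) '' F)) = P := by
  funext E
  have hne : F.Nonempty := by
    obtain ⟨Q, hQ, -⟩ := hlt E 1 one_pos
    exact ⟨Q, hQ⟩
  refine csInf_eq_of_forall_ge_of_forall_gt_exists_lt (hne.image _)
    (Set.forall_mem_image.2 fun Q hQ => hle Q hQ E) fun w hw => ?_
  obtain ⟨Q, hQ, h'⟩ := hlt E (w - P E) (sub_pos.2 hw)
  exact ⟨_, Set.mem_image_of_mem _ hQ, by simpa [restrictTo] using h'⟩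

theorem isLeast_naturalExtension {𝒟 𝒟' : Set (CondEvent Ω)} (h : 𝒟 ⊆ 𝒟') {P : 𝒟 → ℝ}
    (hne : (coherentExtensions h P).Nonempty) :
    IsLeast (coherentExtensions h P) (naturalExtension h P) := by
  refine ⟨⟨wCoherent_sInf hne fun Q hQ => hQ.1, restrictTo_sInf h ?_ ?_⟩, fun Q hQ E => ?_⟩
  · intro Q hQ E
    rw [hQ.2]
  · intro E ε hε
    obtain ⟨Q, hQ⟩ := hne
    refine ⟨Q, hQ, ?_⟩
    rw [hQ.2]
    linarith
  · exact csInf_le ⟨0, Set.forall_mem_image.2 fun Q' hQ' => hQ'.1.nonneg E⟩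
      (Set.mem_image_of_mem _ hQ)

section Unconditional

variable [Nonempty Ω]

theorem given_of_mem_uncondEvents (E : uncondEvents Ω) : E.1.given = Set.univ := by
  obtain ⟨_, A, rfl⟩ := E
  rfl

theorem toUncond_event (A : Set Ω) : (toUncond A).1.event = A := Set.inter_univ A

theorem gain_of_mem_uncondEvents (E : uncondEvents Ω) (p : ℝ) :
    E.1.gain p = E.1.event.indicator 1 - p • (1 : Ω → ℝ) := by
  rw [gain_eq, given_of_mem_uncondEvents, Set.indicator_univ]

/-- The cone of bounded gambles that are at least as good as a finite combination of bets in favour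
of events at their lower probability and a bet against `E₀` at its lower probability. -/
def acceptableCone (P : uncondEvents Ω → ℝ) (E₀ : uncondEvents Ω) : PointedCone ℝ (bddFun Ω) where
  carrier := {f | ∃ (n : ℕ) (E : Fin n → uncondEvents Ω) (s : Fin n → ℝ) (s₀ : ℝ), 0 ≤ s₀ ∧
    (∀ i, 0 ≤ s i) ∧ ∀ ω, (∑ i, s i * (E i).1.gain (P (E i)) ω) - s₀ * E₀.1.gain (P E₀) ω ≤ f.1 ω}
  smul_mem' := by
    rintro ⟨c, hc⟩ f ⟨n, E, s, s₀, hs₀, hs, h⟩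
    refine ⟨n, E, fun i => c * s i, c * s₀, by positivity,
      fun i => mul_nonneg hc (hs i), fun ω => ?_⟩
    have := mul_le_mul_of_nonneg_left (h ω) hc
    simp only [mul_sub, Finset.mul_sum, ← mul_assoc] at this
    exact this
  zero_mem' := ⟨0, Fin.elim0, Fin.elim0, 0, le_rfl, fun i => i.elim0, fun ω => by simp⟩
  add_mem' := by
    rintro f g ⟨n, E, s, s₀, hs₀, hs, h⟩ ⟨m, E', s', s₀', hs₀', hs', h'⟩
    refine ⟨n + m, Fin.append E E', Fin.append s s', s₀ + s₀', by positivity,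
      fun i => Fin.addCases (by simpa using hs) (by simpa using hs') i, fun ω => ?_⟩
    have := add_le_add (h ω) (h' ω)
    simp only [Fin.sum_univ_add, Fin.append_left, Fin.append_right]
    refine le_trans (le_of_eq ?_) this
    ring

theorem mem_acceptableCone_of_nonneg (P : uncondEvents Ω → ℝ) (E₀ : uncondEvents Ω)
    {f : bddFun Ω} (hf : 0 ≤ f.1) : f ∈ acceptableCone P E₀ :=
  ⟨0, Fin.elim0, Fin.elim0, 0, le_rfl, fun i => i.elim0, fun ω => by simpa using hf ω⟩

/-- A W-coherent lower probability on all events is dominated by an expectation that agrees with it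
at a prescribed event. -/
theorem WCoherent.exists_expectation {P : uncondEvents Ω → ℝ} (hP : WCoherent P)
    (E₀ : uncondEvents Ω) :
    ∃ L, IsExpectation L ∧ (∀ E : uncondEvents Ω, P E ≤ L (E.1.event.indicator 1)) ∧
      L (E₀.1.event.indicator 1) = P E₀ := by
  have hone : (⟨1, IsBddFun.one⟩ : bddFun Ω) ≠ 0 := by
    intro h
    have := congrFun (congrArg Subtype.val h) (Classical.arbitrary Ω)
    simp at this
  set u : bddFun Ω := ⟨1, IsBddFun.one⟩ with hu
  obtain ⟨g, hg1, hg⟩ := riesz_extension (acceptableCone P E₀)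
    (LinearPMap.mkSpanSingleton u (1 : ℝ) hone) (by
      rintro ⟨x, hx⟩ hmem
      obtain ⟨c, rfl⟩ := Submodule.mem_span_singleton.1 hx
      rw [LinearPMap.mkSpanSingleton'_apply]
      obtain ⟨n, E, s, s₀, hs₀, hs, h⟩ := hmem
      refine le_of_forall_pos_lt_add fun ε hε => ?_
      obtain ⟨ω, -, hlt⟩ := exists_neg_lt_of_sSup_image_nonneg
        (E₀.1.given_nonempty.mono Set.subset_union_left) (hP n E₀ E s₀ s hs₀ hs) hε
      have := h ω
      simp [hu] at this hlt ⊢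
      linarith) (by
      intro y
      obtain ⟨C, hC⟩ := y.2
      refine ⟨⟨C • u, Submodule.mem_span_singleton.2 ⟨C, rfl⟩⟩,
        mem_acceptableCone_of_nonneg P E₀ ?_⟩
      intro ω
      have := neg_abs_le (y.1 ω)
      have := hC ω
      simp [hu]
      linarith)
  obtain ⟨L, hL⟩ := LinearMap.exists_extend g
  have hLg : ∀ f (hf : IsBddFun f), L f = g ⟨f, hf⟩ := fun f hf => by rw [← hL]; rfl
  have hL1 : L 1 = 1 := by
    rw [hLg 1 .one]
    have := hg1 ⟨u, Submodule.mem_span_singleton_self u⟩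
    rw [LinearPMap.mkSpanSingleton_apply] at this
    exact this
  refine ⟨L, ⟨fun f hf h => ?_, hL1⟩, fun E => ?_, le_antisymm ?_ ?_⟩
  · rw [hLg f hf]
    exact hg _ (mem_acceptableCone_of_nonneg P E₀ h)
  · have hmem := hg ⟨E.1.gain (P E), isBddFun_gain _ _⟩ ⟨1, fun _ => E, fun _ => 1, 0, le_rfl,
      fun _ => zero_le_one, fun ω => by simp⟩
    rw [← hLg, gain_of_mem_uncondEvents, map_sub, map_smul, hL1, smul_eq_mul] at hmem
    linarith
  · have hmem := hg ⟨(-1 : ℝ) • E₀.1.gain (P E₀), (isBddFun_gain _ _).smul _⟩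
      ⟨0, Fin.elim0, Fin.elim0, 1, zero_le_one, fun i => i.elim0, fun ω => by simp⟩
    rw [← hLg, map_smul, gain_of_mem_uncondEvents, map_sub, map_smul, hL1, smul_eq_mul,
      smul_eq_mul] at hmem
    linarith
  · have hmem := hg ⟨E₀.1.gain (P E₀), isBddFun_gain _ _⟩ ⟨1, fun _ => E₀, fun _ => 1, 0, le_rfl,
      fun _ => zero_le_one, fun ω => by simp⟩
    rw [← hLg, gain_of_mem_uncondEvents, map_sub, map_smul, hL1, smul_eq_mul] at hmem
    linarith

/-- Every precise probability on all events is the restriction of an expectation. -/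
theorem DFCoherent.exists_expectation {Q : uncondEvents Ω → ℝ} (hQ : DFCoherent Q) :
    ∃ L, IsExpectation L ∧ ∀ E : uncondEvents Ω, L (E.1.event.indicator 1) = Q E := by
  obtain ⟨L, hL, hdom, -⟩ := hQ.wCoherent.exists_expectation (toUncond ∅)
  refine ⟨L, hL, fun E => le_antisymm ?_ (hdom E)⟩
  have hcompl := hdom (toUncond E.1.eventᶜ)
  rw [toUncond_event, hL.indicator_compl] at hcompl
  have hadd : 1 ≤ Q E + Q (toUncond E.1.eventᶜ) := by
    refine le_of_forall_pos_lt_add fun ε hε => ?_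
    have h := hQ 1 ![E, toUncond E.1.eventᶜ] ![-1, -1]
    obtain ⟨ω, -, hlt⟩ := exists_neg_lt_of_sSup_image_nonneg
      (E.1.given_nonempty.mono (Set.subset_iUnion_of_subset 0 subset_rfl)) h hε
    have hsum : -ε < ∑ i : Fin 2, ![(-1 : ℝ), -1] i * (![E, toUncond E.1.eventᶜ] i).1.gain
        (Q (![E, toUncond E.1.eventᶜ] i)) ω := hlt
    rw [Fin.sum_univ_two] at hsum
    simp only [Matrix.cons_val_zero, Matrix.cons_val_one, gain_of_mem_uncondEvents,
      toUncond_event, Set.indicator_compl, Pi.sub_apply, Pi.smul_apply, Pi.one_apply,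
      smul_eq_mul] at hsum
    linarith
  linarith

end Unconditional

open Classical in
/-- The conditional probability induced by `L`; conditionally on an event of probability zero, all
mass is put on a chosen point of that event. -/
noncomputable def condProb (L : (Ω → ℝ) →ₗ[ℝ] ℝ) (E : CondEvent Ω) : ℝ :=
  if 0 < L (E.given.indicator 1) then L (E.event.indicator 1) / L (E.given.indicator 1)
  else E.event.indicator 1 E.given_nonempty.some

theorem IsExpectation.gain_condProb {L : (Ω → ℝ) →ₗ[ℝ] ℝ} (hL : IsExpectation L)
    (E : CondEvent Ω) : L (E.gain (condProb L E)) = 0 := by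
  rw [gain_eq, map_sub, map_smul, smul_eq_mul]
  by_cases h : 0 < L (E.given.indicator 1)
  · rw [condProb, if_pos h, div_mul_cancel₀ _ h.ne', sub_self]
  · have hg : L (E.given.indicator 1) = 0 := le_antisymm (not_lt.1 h) (hL.indicator_nonneg _)
    have he : L (E.event.indicator 1) ≤ L (E.given.indicator 1) :=
      hL.mono (.indicator_one _) (.indicator_one _)
        (Set.indicator_le_indicator_of_subset E.event_subset fun _ => zero_le_one)
    rw [hg, mul_zero, sub_zero]
    exact le_antisymm (he.trans_eq hg) (hL.indicator_nonneg _)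

section Conditional

variable [Nonempty Ω] {L : (Ω → ℝ) →ₗ[ℝ] ℝ} {P : uncondEvents Ω → ℝ} {B : Set Ω}
  {hB : B.Nonempty}

theorem IsExpectation.condProb_uncond (hL : IsExpectation L) (E : uncondEvents Ω) :
    condProb L E.1 = L (E.1.event.indicator 1) := by
  have h : L (E.1.given.indicator 1) = 1 := by
    rw [given_of_mem_uncondEvents, Set.indicator_univ, hL.map_one]
  rw [condProb, h, if_pos zero_lt_one, div_one]

theorem IsExpectation.dfCoherent_uncond (hL : IsExpectation L) :
    DFCoherent (fun E : uncondEvents Ω => L (E.1.event.indicator 1)) := by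
  refine dfCoherent_of_expectation fun n E => ⟨L, hL, fun i => ?_, 0, ?_⟩
  · rw [← hL.condProb_uncond, hL.gain_condProb]
  · rw [given_of_mem_uncondEvents, Set.indicator_univ, hL.map_one]
    exact zero_lt_one

theorem IsExpectation.dfCoherent_condProb (hL : IsExpectation L) :
    DFCoherent (fun E : condDomain B hB => condProb L E.1) := by
  refine dfCoherent_of_expectation fun n E => ?_
  by_cases h : ∃ i, 0 < L ((E i).1.given.indicator 1)
  · exact ⟨L, hL, fun i => hL.gain_condProb _, h⟩
  push Not at h
  have hgiven : ∀ i, (E i).1.given = B := by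
    intro i
    rcases (E i).2 with hE | ⟨A, hA⟩
    · have := h i
      rw [given_of_mem_uncondEvents ⟨_, hE⟩, Set.indicator_univ, hL.map_one] at this
      exact absurd this (not_le.2 zero_lt_one)
    · rw [← hA]
      rfl
  refine ⟨_, .proj hB.some, fun i => ?_, 0, ?_⟩
  · have hsome : (E i).1.given_nonempty.some = hB.some := by
      congr 1
      exact hgiven i
    rw [condProb, if_neg (not_lt.2 (h i)), hsome]
    simp [gain]
  · simp [hgiven, hB.some_mem]

theorem restrictTo_condProb (hL : IsExpectation L) :
    restrictTo (uncondEvents_subset_condDomain B hB) (fun E => condProb L E.1) =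
      fun E => L (E.1.event.indicator 1) :=
  funext hL.condProb_uncond

theorem IsExpectation.mem_credalPos (hL : IsExpectation L)
    (hdom : ∀ E : uncondEvents Ω, P E ≤ L (E.1.event.indicator 1))
    (hpos : 0 < L (B.indicator 1)) :
    (fun E : uncondEvents Ω => L (E.1.event.indicator 1)) ∈ credalPos P B :=
  ⟨⟨hL.dfCoherent_uncond, hdom⟩, by simpa only [toUncond_event] using hpos⟩

theorem IsExpectation.mem_credalPosCond (hL : IsExpectation L)
    (hdom : ∀ E : uncondEvents Ω, P E ≤ L (E.1.event.indicator 1))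
    (hpos : 0 < L (B.indicator 1)) :
    (fun E : condDomain B hB => condProb L E.1) ∈ credalPosCond P B hB :=
  ⟨hL.dfCoherent_condProb, by
    rw [restrictTo_condProb hL]
    exact hL.mem_credalPos hdom hpos⟩

theorem WCoherent.coherentExtensions_nonempty (hP : WCoherent P) :
    (coherentExtensions (uncondEvents_subset_condDomain B hB) P).Nonempty := by
  let F : Set (condDomain B hB → ℝ) := {Q | ∃ L, IsExpectation L ∧
    (∀ E : uncondEvents Ω, P E ≤ L (E.1.event.indicator 1)) ∧ Q = fun E => condProb L E.1}
  refine ⟨_, wCoherent_sInf (F := F) ?_ ?_, restrictTo_sInf _ ?_ ?_⟩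
  · obtain ⟨L, hL, hdom, -⟩ := hP.exists_expectation (toUncond ∅)
    exact ⟨_, L, hL, hdom, rfl⟩
  · rintro _ ⟨L, hL, -, rfl⟩
    exact hL.dfCoherent_condProb.wCoherent
  · rintro _ ⟨L, hL, hdom, rfl⟩ E
    rw [restrictTo_condProb hL]
    exact hdom E
  · intro E ε hε
    obtain ⟨L, hL, hdom, heq⟩ := hP.exists_expectation E
    refine ⟨_, ⟨L, hL, hdom, rfl⟩, ?_⟩
    simp only [restrictTo_condProb hL, heq]
    linarith

theorem WCoherent.credalPos_nonempty (hP : WCoherent P) (h : 0 < upperProb P B) :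
    (credalPos P B).Nonempty := by
  obtain ⟨L, hL, hdom, heq⟩ := hP.exists_expectation (toUncond Bᶜ)
  refine ⟨_, hL.mem_credalPos hdom ?_⟩
  rw [toUncond_event, hL.indicator_compl] at heq
  rw [upperProb] at h
  linarith

/-- If some member of the credal set gives `B` positive probability, the lower envelope of `M⁺_B` is
a W-coherent extension of `P`. -/
theorem WCoherent.regularEnvelope_mem (hP : WCoherent P) (hne : (credalPos P B).Nonempty) :
    regularEnvelope P B hB ∈ coherentExtensions (uncondEvents_subset_condDomain B hB) P := by
  obtain ⟨Q, ⟨hQ, hPQ⟩, hQB⟩ := hne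
  obtain ⟨L, hL, hLQ⟩ := hQ.exists_expectation
  have hLdom : ∀ E : uncondEvents Ω, P E ≤ L (E.1.event.indicator 1) := fun E => by
    rw [hLQ]
    exact hPQ E
  have hLB : 0 < L (B.indicator 1) := by
    rwa [← hLQ, toUncond_event] at hQB
  refine ⟨wCoherent_sInf ⟨_, hL.mem_credalPosCond hLdom hLB⟩ fun R hR => hR.1.wCoherent,
    restrictTo_sInf _ (fun R hR => hR.2.1.2) fun E ε hε => ?_⟩
  obtain ⟨L₀, hL₀, hdom₀, heq₀⟩ := hP.exists_expectation E
  obtain ⟨t, ht0, ht1, htε⟩ : ∃ t : ℝ, 0 < t ∧ t ≤ 1 ∧ t < ε :=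
    ⟨min 1 (ε / 2), lt_min one_pos (half_pos hε), min_le_left _ _,
      (min_le_right _ _).trans_lt (half_lt_self hε)⟩
  have hmix := hL₀.convexCombo hL ht0.le ht1
  have happ : ∀ f, ((1 - t) • L₀ + t • L) f = (1 - t) * L₀ f + t * L f := fun f => rfl
  refine ⟨_, hmix.mem_credalPosCond (fun E' => ?_) ?_, ?_⟩
  · rw [happ]
    nlinarith [hdom₀ E', hLdom E']
  · rw [happ]
    have := mul_nonneg (sub_nonneg.2 ht1) (hL₀.indicator_nonneg B)
    have := mul_pos ht0 hLB
    linarith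
  · rw [restrictTo_condProb hmix]
    simp only [happ, heq₀]
    have := mul_le_mul_of_nonneg_left (hL.indicator_le_one E.1.event) ht0.le
    have := mul_nonneg ht0.le (hP.nonneg E)
    linarith

end Conditional

end Coherence

theorem proposition13 {Ω : Type*} [Nonempty Ω] (P : uncondEvents Ω → ℝ) (hP : WCoherent P)
    (B : Set Ω) (hB : B.Nonempty) :
    -- the case `P(B) = 0 < upperProb(B)`
    (P (toUncond B) = 0 → 0 < upperProb P B →
      (credalPos P B).Nonempty ∧
      WCoherent (regularEnvelope P B hB) ∧
      restrictTo (uncondEvents_subset_condDomain B hB) (regularEnvelope P B hB) = P) ∧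
    -- the general case, with the natural extension being the least W-coherent extension
    (IsLeast (coherentExtensions (uncondEvents_subset_condDomain B hB) P)
        (naturalExtension (uncondEvents_subset_condDomain B hB) P) ∧
      WCoherent (regularExtension P B hB) ∧
      restrictTo (uncondEvents_subset_condDomain B hB) (regularExtension P B hB) =
        restrictTo (uncondEvents_subset_condDomain B hB)
          (naturalExtension (uncondEvents_subset_condDomain B hB) P) ∧
      restrictTo (uncondEvents_subset_condDomain B hB) (regularExtension P B hB) = P) := by
  have hleast := isLeast_naturalExtension (uncondEvents_subset_condDomain B hB)
    (hP.coherentExtensions_nonempty (hB := hB))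
  have hreg : regularExtension P B hB ∈
      coherentExtensions (uncondEvents_subset_condDomain B hB) P := by
    rw [regularExtension]
    split_ifs with h
    · exact hP.regularEnvelope_mem h
    · exact hleast.1
  refine ⟨fun _ h => ?_, hleast, hreg.1, hreg.2.trans hleast.1.2.symm, hreg.2⟩
  have hne := hP.credalPos_nonempty h
  exact ⟨hne, hP.regularEnvelope_mem hne⟩
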